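/- Let $\varphi(x)=\sum_{k=0}^n a_kx^k$ be a real polynomial all of whose complex zeros are real and negative (so $\varphi$ is not the zero polynomial; nonzero constants are allowed), and set $a_k=0$ for every integer $k\notin\{0,1,\dots,n\}$. Then for every positive integer $p$, all complex zeros of the polynomial $$\sum_{j=1}^p\left((-1)^{j+1}\binom{2p}{p-j}\sum_{k=0}^n\left(a_k^2-a_{k-j}a_{k+j}\right)x^k\right)$$ are real and negative (in particular, this polynomial is not identically zero). -/

import Mathlib

open Polynomial

/-- The coefficient `a_k` of the real polynomial `φ = ∑ a_k x^k` for an arbitrary integer index `k`: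
it is `0` whenever `k < 0` (and, as for every polynomial, whenever `k > deg φ`). -/
noncomputable def intCoeff (φ : ℝ[X]) (k : ℤ) : ℝ :=
  if k < 0 then 0 else φ.coeff k.toNat

/-- All the (complex) zeros of the real polynomial `φ` are real and negative. The zero polynomial,
which vanishes at every complex number, does not have this property; nonzero constants do. -/
def HasOnlyRealNegativeZeros (φ : ℝ[X]) : Prop :=
  ∀ z : ℂ, aeval z φ = 0 → z.im = 0 ∧ z.re < 0

/-- The polynomial `∑_{k=0}^n (a_k² - a_{k-r} a_{k+r}) x^k` obtained by letting the operator
`a_k ↦ a_k² - a_{k-r} a_{k+r}` act on `φ = ∑_{k=0}^n a_k x^k`. -/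
noncomputable def fiskOperator (r n : ℕ) (φ : ℝ[X]) : ℝ[X] :=
  ∑ k ∈ Finset.range (n + 1),
    C (intCoeff φ (k : ℤ) ^ 2
        - intCoeff φ ((k : ℤ) - (r : ℤ)) * intCoeff φ ((k : ℤ) + (r : ℤ))) * X ^ k

/-! Let `L f = CT(f * (z - z⁻¹)^(2p))`, with CT the constant term. Extracting coefficients shows
that twice the given polynomial at `x = t²` is `(-1)^p L(φ(tz) φ(t/z))`, so it suffices that this is
nonzero for `Re t > 0` and for `t = 0`: both square roots of a zero are then purely imaginary and
nonzero.

Put `v = z + z⁻¹`. A zero `r < 0` of `φ` contributes `(tz - r)(t/z - r) = -rt (w_r + v)`, where `w_r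
= t/(-r) + (-r)/t` lies in the right half-plane. A Grace–Walsh–Szegő argument
(`functional_prod_ne_zero`) reduces the nonvanishing of `L(∏ (w_r + v))` to that of `L((w + v)^n)`
for `Re w > 0`.

Writing `w = t + t⁻¹`, the latter is `(-1)^p t^(-n)` times `dixonPolynomial n p` at `t²`. A
Rodrigues formula and Gauss–Lucas make all zeros of that polynomial negative, which excludes `Re t >
0`. -/

/-! ### Laguerre's theorem for a half-plane. -/

/-- The closed disc with centre `a` and radius `a` is the image of the half-plane
`1 ≤ 2 * a * re d` under inversion. -/
theorem norm_inv_sub_ofReal_le_iff {a : ℝ} (ha : 0 < a) {d : ℂ} (hd : d ≠ 0) :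
    ‖d⁻¹ - (a : ℂ)‖ ≤ a ↔ 1 ≤ 2 * a * d.re := by
  have h1 : d⁻¹ - (a : ℂ) = (1 - a * d) / d := by field_simp
  have hd' : 0 < ‖d‖ := norm_pos_iff.2 hd
  rw [h1, norm_div, div_le_iff₀ hd', ← sq_le_sq₀ (norm_nonneg _) (by positivity), mul_pow,
    Complex.sq_norm, Complex.sq_norm, Complex.normSq_apply, Complex.normSq_apply]
  simp only [Complex.sub_re, Complex.sub_im, Complex.mul_re, Complex.mul_im, Complex.ofReal_re,
    Complex.ofReal_im, Complex.one_re, Complex.one_im]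
  constructor <;> intro h <;> nlinarith

/-- Convexity of the disc, in summed form to avoid dividing by the cardinality. -/
theorem norm_multiset_sum_sub_card_mul_le (a : ℝ) (s : Multiset ℂ)
    (hs : ∀ u ∈ s, ‖u - (a : ℂ)‖ ≤ a) :
    ‖s.sum - (Multiset.card s : ℂ) * a‖ ≤ (Multiset.card s : ℝ) * a := by
  induction s using Multiset.induction_on with
  | empty => simp
  | cons u s ih =>
    have h1 := ih fun x hx => hs x (Multiset.mem_cons_of_mem hx)
    have h2 := hs u (Multiset.mem_cons_self u s)
    rw [Multiset.sum_cons, Multiset.card_cons]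
    push_cast
    calc ‖u + s.sum - ((Multiset.card s : ℂ) + 1) * a‖
        = ‖(u - a) + (s.sum - (Multiset.card s : ℂ) * a)‖ := by congr 1; ring
      _ ≤ _ := norm_add_le _ _
      _ ≤ _ := by linarith

/-- **Laguerre's theorem** for the half-plane: polar derivatives with respect to a point of the
right half-plane preserve the absence of zeros in that half-plane. -/
theorem polar_derivative_ne_zero {P : ℂ[X]} (hdeg : 0 < P.natDegree)
    (hP : ∀ w : ℂ, 0 < w.re → P.eval w ≠ 0) {w ζ : ℂ} (hw : 0 < w.re) (hζ : 0 < ζ.re) :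
    (P.natDegree : ℂ) * P.eval w + (ζ - w) * P.derivative.eval w ≠ 0 := by
  intro h0
  have hN : (P.natDegree : ℂ) ≠ 0 := by exact_mod_cast hdeg.ne'
  have hNr : (0 : ℝ) < P.natDegree := by exact_mod_cast hdeg
  have hPw := hP w hw
  have hsp : P.Splits := IsAlgClosed.splits P
  have hquot := hsp.eval_derivative_div_eval_of_ne_zero hPw
  have hd : w - ζ ≠ 0 := by
    intro hd
    rw [sub_eq_zero] at hd
    subst hd
    simp [hN, hPw] at h0
  -- With this radius, `1 / (w - z)` lies in the disc exactly when `Re z ≤ 0`.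
  set a : ℝ := 1 / (2 * w.re) with ha
  have hapos : 0 < a := by positivity
  have h2a : 2 * a * w.re = 1 := by rw [ha]; field_simp
  have hsum := norm_multiset_sum_sub_card_mul_le a (P.roots.map fun z => 1 / (w - z)) (by
    intro u hu
    obtain ⟨z, hz, rfl⟩ := Multiset.mem_map.1 hu
    have hz0 : P.eval z = 0 := (mem_roots'.1 hz).2
    have hzre : z.re ≤ 0 := not_lt.1 fun h => hP z h hz0
    have hwz : w - z ≠ 0 := by
      intro h
      rw [sub_eq_zero.1 h] at hPw
      exact hPw hz0
    rw [one_div, norm_inv_sub_ofReal_le_iff hapos hwz, Complex.sub_re]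
    nlinarith)
  rw [← hquot, Multiset.card_map, ← hsp.natDegree_eq_card_roots] at hsum
  -- A vanishing polar derivative makes `1 / (w - ζ)` the mean of the `1 / (w - z)` over the roots,
  -- hence a point of the disc, so `Re ζ ≤ 0`.
  have hq : P.derivative.eval w / P.eval w = P.natDegree * (w - ζ)⁻¹ := by
    field_simp
    linear_combination -h0
  rw [hq, ← mul_sub, norm_mul, Complex.norm_natCast] at hsum
  have h1 := (norm_inv_sub_ofReal_le_iff hapos hd).1 (le_of_mul_le_mul_left hsum hNr)
  rw [Complex.sub_re] at h1
  nlinarith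

/-! ### Grace–Walsh–Szegő for linear functionals. -/

section Polarization

variable {A : Type*} [CommRing A] [Algebra ℂ A]

/-- The polynomial `w ↦ L ((w + v) ^ n)`. -/
noncomputable def momentPolynomial (L : A →ₗ[ℂ] ℂ) (v : A) (n : ℕ) : ℂ[X] :=
  ∑ k ∈ Finset.range (n + 1), C ((n.choose k : ℂ) * L (v ^ (n - k))) * X ^ k

theorem coeff_momentPolynomial (L : A →ₗ[ℂ] ℂ) (v : A) (n k : ℕ) :
    (momentPolynomial L v n).coeff k = (n.choose k : ℂ) * L (v ^ (n - k)) := by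
  simp only [momentPolynomial, finsetSum_coeff, coeff_C_mul_X_pow]
  rw [Finset.sum_ite_eq]
  split_ifs with h
  · rfl
  · rw [Nat.choose_eq_zero_of_lt (by simpa using h)]; simp

theorem eval_momentPolynomial (L : A →ₗ[ℂ] ℂ) (v : A) (n : ℕ) (w : ℂ) :
    (momentPolynomial L v n).eval w = L ((algebraMap ℂ A w + v) ^ n) := by
  rw [add_pow, map_sum, momentPolynomial, eval_finsetSum]
  refine Finset.sum_congr rfl fun k _ => ?_
  have : algebraMap ℂ A w ^ k * v ^ (n - k) * (n.choose k : A)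
      = (w ^ k * (n.choose k : ℂ)) • v ^ (n - k) := by
    rw [Algebra.smul_def, map_mul, map_pow, map_natCast]; ring
  rw [this, map_smul, smul_eq_mul]
  simp
  ring

theorem derivative_momentPolynomial (L : A →ₗ[ℂ] ℂ) (v : A) (n : ℕ) :
    (momentPolynomial L v (n + 1)).derivative = C ((n : ℂ) + 1) * momentPolynomial L v n := by
  ext k
  rw [coeff_derivative, coeff_C_mul, coeff_momentPolynomial, coeff_momentPolynomial,
    Nat.add_sub_add_right]
  have : ((n : ℂ) + 1) * n.choose k = (n + 1).choose (k + 1) * (k + 1) := by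
    exact_mod_cast Nat.add_one_mul_choose_eq n k
  linear_combination (-L (v ^ (n - k))) * this

theorem natDegree_momentPolynomial {L : A →ₗ[ℂ] ℂ} (hL : L 1 ≠ 0) (v : A) (n : ℕ) :
    (momentPolynomial L v n).natDegree = n := by
  refine natDegree_eq_of_le_of_coeff_ne_zero ?_ ?_
  · refine natDegree_le_iff_coeff_eq_zero.2 fun k hk => ?_
    rw [coeff_momentPolynomial, Nat.choose_eq_zero_of_lt hk]; simp
  · simpa [coeff_momentPolynomial] using hL

/-- A **Grace–Walsh–Szegő** theorem for the right half-plane, for symmetric multi-affine forms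
`L (∏ (wᵢ + v))` given by a linear functional `L`. -/
theorem functional_prod_ne_zero (v : A) (n : ℕ) :
    ∀ L : A →ₗ[ℂ] ℂ, L 1 ≠ 0 →
      (∀ w : ℂ, 0 < w.re → L ((algebraMap ℂ A w + v) ^ n) ≠ 0) →
      ∀ s : Multiset ℂ, Multiset.card s = n → (∀ w ∈ s, 0 < w.re) →
        L (s.map fun w => algebraMap ℂ A w + v).prod ≠ 0 := by
  induction n with
  | zero =>
    intro L hL _ s hs _
    rw [Multiset.card_eq_zero.1 hs]
    simpa using hL
  | succ n ih =>
    intro L hL hdiag s hs hpos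
    obtain ⟨ζ, hmem⟩ := Multiset.card_pos_iff_exists_mem.1 (by omega : 0 < Multiset.card s)
    obtain ⟨s, rfl⟩ := Multiset.exists_cons_of_mem hmem
    have hζ : 0 < ζ.re := hpos ζ (Multiset.mem_cons_self _ _)
    have hn0 : ((n : ℂ) + 1) ≠ 0 := by exact_mod_cast Nat.succ_ne_zero n
    set P := momentPolynomial L v (n + 1) with hPdef
    have hdeg : P.natDegree = n + 1 := natDegree_momentPolynomial hL v (n + 1)
    have hP : ∀ w : ℂ, 0 < w.re → P.eval w ≠ 0 := fun w hw => by
      rw [hPdef, eval_momentPolynomial]; exact hdiag w hw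
    -- One factor `ζ + v` is absorbed into the functional; the induction hypothesis is then applied
    -- to `M`.
    let M : A →ₗ[ℂ] ℂ := L.comp (LinearMap.mulLeft ℂ (algebraMap ℂ A ζ + v))
    have hM : ∀ x, M x = ζ * L x + L (v * x) := fun x => by
      simp only [M, LinearMap.comp_apply, LinearMap.mulLeft_apply, add_mul, map_add]
      rw [← Algebra.smul_def, map_smul, smul_eq_mul]
    have key := ih M ?_ ?_ s (by simpa using hs)
      (fun w hw => hpos w (Multiset.mem_cons_of_mem hw))
    · simpa [M] using key
    -- If `M 1 = 0`, comparing the two top coefficients of `P` makes `ζ` the mean of its roots, all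
    -- of which have nonpositive real part.
    · rw [hM, mul_one]
      intro h0
      have hnext := (IsAlgClosed.splits P).nextCoeff_eq_neg_sum_roots_mul_leadingCoeff
      rw [nextCoeff_of_natDegree_pos (by omega), leadingCoeff, hdeg, hPdef,
        coeff_momentPolynomial, coeff_momentPolynomial, ← hPdef] at hnext
      simp only [Nat.add_sub_cancel, Nat.choose_self, Nat.sub_self, pow_zero, Nat.cast_one,
        one_mul, Nat.choose_succ_self_right, Nat.add_sub_cancel_left, pow_one] at hnext
      have hre : P.roots.sum.re ≤ 0 := by
        have : P.roots.sum.re = (P.roots.map Complex.re).sum :=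
          map_multiset_sum Complex.reAddGroupHom P.roots
        rw [this]
        refine (Multiset.sum_le_card_nsmul _ 0 fun x hx => ?_).trans_eq (smul_zero _)
        obtain ⟨z, hz, rfl⟩ := Multiset.mem_map.1 hx
        exact not_lt.1 fun h => hP z h (mem_roots'.1 hz).2
      have hroot : P.roots.sum = ((n : ℂ) + 1) * ζ := by
        apply mul_left_cancel₀ hL
        push_cast at hnext
        linear_combination (-(n : ℂ) - 1) * h0 + hnext
      have := congrArg Complex.re hroot
      rw [show ((n : ℂ) + 1) = (((n : ℝ) + 1 : ℝ) : ℂ) by push_cast; rfl,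
        Complex.re_ofReal_mul] at this
      have hpos' : 0 < ((n : ℝ) + 1) * ζ.re := by positivity
      linarith
    -- The polar derivative of `P` at `w` with pole `ζ` is `(n + 1) * M ((w + v)^n)`.
    · intro w hw h0
      apply polar_derivative_ne_zero (by omega) hP hw hζ
      rw [hdeg, hPdef, derivative_momentPolynomial, eval_mul, eval_C, eval_momentPolynomial,
        eval_momentPolynomial]
      rw [hM] at h0
      have : (algebraMap ℂ A w + v) ^ (n + 1)
          = w • (algebraMap ℂ A w + v) ^ n + v * (algebraMap ℂ A w + v) ^ n := by
        rw [Algebra.smul_def]; ring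
      rw [this, map_add, map_smul, smul_eq_mul]
      push_cast
      linear_combination ((n : ℂ) + 1) * h0

end Polarization

/-! ### Dixon coefficients and their recurrence. -/

/-- The reciprocal factorial `1 / m!`, extended by zero to negative integers. -/
noncomputable def invFactorial (m : ℤ) : ℝ :=
  if m < 0 then 0 else ((m.toNat).factorial : ℝ)⁻¹

theorem invFactorial_natCast (m : ℕ) : invFactorial (m : ℤ) = (m.factorial : ℝ)⁻¹ := by
  simp [invFactorial]

theorem invFactorial_of_neg {m : ℤ} (hm : m < 0) : invFactorial m = 0 := by
  simp [invFactorial, hm]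

theorem invFactorial_sub_one (m : ℤ) : invFactorial (m - 1) = m * invFactorial m := by
  rcases lt_trichotomy m 0 with h | rfl | h
  · rw [invFactorial_of_neg h, invFactorial_of_neg (by omega), mul_zero]
  · rw [invFactorial_of_neg (by norm_num)]; simp
  · obtain ⟨k, rfl⟩ : ∃ k : ℕ, m = k + 1 := ⟨(m - 1).toNat, by omega⟩
    rw [add_sub_cancel_right, invFactorial_natCast,
      show ((k : ℤ) + 1) = ((k + 1 : ℕ) : ℤ) by push_cast; rfl, invFactorial_natCast,
      Nat.factorial_succ]
    push_cast
    have : (k.factorial : ℝ) ≠ 0 := by positivity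
    field_simp

/-- The closed form, given by Dixon's identity, of the sum over `j` of
`(-1) ^ j * (2p choose p+j) * (n choose k-j) * (n choose k+j)`. -/
noncomputable def dixonCoeff (n p : ℕ) (k : ℤ) : ℝ :=
  ((2 * p).factorial : ℝ) / p.factorial * (n.factorial * (n + p).factorial) *
    (invFactorial (p + k) * invFactorial (p + n - k) * invFactorial k * invFactorial (n - k))

/-- The coefficient form of `t²(v² - 4) = X₀² - 2(1 + t²)X₀ + (1 - t²)²` for `X₀ = 1 + t² + tv`; it
drives the induction on `p`. Every reciprocal factorial is a polynomial multiple of one of `g1`, …,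
`g4`, which leaves a polynomial identity. -/
theorem dixonCoeff_recurrence (n p : ℕ) (k : ℤ) :
    -dixonCoeff n (p + 1) (k - 1) =
      dixonCoeff (n + 2) p k - 2 * dixonCoeff (n + 1) p k - 2 * dixonCoeff (n + 1) p (k - 1)
        + dixonCoeff n p k - 2 * dixonCoeff n p (k - 1) + dixonCoeff n p (k - 2) := by
  have h1 : ∀ m : ℤ, invFactorial (m - 2) = (m - 1) * m * invFactorial m := fun m => by
    rw [show m - 2 = (m - 1) - 1 by ring, invFactorial_sub_one, invFactorial_sub_one]
    push_cast; ring
  set g1 := invFactorial (p + k) with hg1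
  set g2 := invFactorial (p + n + 2 - k) with hg2
  set g3 := invFactorial k with hg3
  set g4 := invFactorial (n + 2 - k) with hg4
  have a1 : invFactorial ((p : ℤ) + (k - 1)) = (p + k) * g1 := by
    rw [show (p : ℤ) + (k - 1) = (p + k) - 1 by ring, invFactorial_sub_one]; push_cast; rfl
  have a2 : invFactorial ((p : ℤ) + (k - 2)) = (p + k - 1) * (p + k) * g1 := by
    rw [show (p : ℤ) + (k - 2) = (p + k) - 2 by ring, h1]; push_cast; rfl
  have a3 : invFactorial ((p : ℤ) + 1 + (k - 1)) = g1 := by rw [hg1]; congr 1; ring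
  have b0 : invFactorial ((p : ℤ) + (n + 2) - k) = g2 := by rw [hg2]; congr 1
  have b1 : invFactorial ((p : ℤ) + (n + 1) - k) = (p + n + 2 - k) * g2 := by
    rw [show (p : ℤ) + (n + 1) - k = (p + n + 2 - k) - 1 by ring, invFactorial_sub_one]
    push_cast; rfl
  have b2 : invFactorial ((p : ℤ) + (n + 1) - (k - 1)) = g2 := by rw [hg2]; congr 1; ring
  have b3 : invFactorial ((p : ℤ) + n - k) = (p + n + 2 - k - 1) * (p + n + 2 - k) * g2 := by
    rw [show (p : ℤ) + n - k = (p + n + 2 - k) - 2 by ring, h1]; push_cast; rfl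
  have b4 : invFactorial ((p : ℤ) + n - (k - 1)) = (p + n + 2 - k) * g2 := by
    rw [show (p : ℤ) + n - (k - 1) = (p + n + 2 - k) - 1 by ring, invFactorial_sub_one]
    push_cast; rfl
  have b5 : invFactorial ((p : ℤ) + n - (k - 2)) = g2 := by rw [hg2]; congr 1; ring
  have b6 : invFactorial ((p : ℤ) + 1 + n - (k - 1)) = g2 := by rw [hg2]; congr 1; ring
  have c1 : invFactorial (k - 1) = k * g3 := invFactorial_sub_one k
  have c2 : invFactorial (k - 2) = (k - 1) * k * g3 := h1 k
  have d0 : invFactorial ((n : ℤ) + 1 - k) = (n + 2 - k) * g4 := by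
    rw [show (n : ℤ) + 1 - k = (n + 2 - k) - 1 by ring, invFactorial_sub_one]; push_cast; rfl
  have d1 : invFactorial ((n : ℤ) + 1 - (k - 1)) = g4 := by rw [hg4]; congr 1; ring
  have d2 : invFactorial ((n : ℤ) - k) = (n + 2 - k - 1) * (n + 2 - k) * g4 := by
    rw [show (n : ℤ) - k = (n + 2 - k) - 2 by ring, h1]; push_cast; rfl
  have d3 : invFactorial ((n : ℤ) - (k - 1)) = (n + 2 - k) * g4 := by
    rw [show (n : ℤ) - (k - 1) = (n + 2 - k) - 1 by ring, invFactorial_sub_one]; push_cast; rfl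
  have d4 : invFactorial ((n : ℤ) - (k - 2)) = g4 := by rw [hg4]; congr 1; ring
  simp only [dixonCoeff, Nat.cast_add, Nat.cast_one, Nat.cast_ofNat]
  rw [a1, a2, a3, b0, b1, b2, b3, b4, b5, b6, c1, c2, d0, d1, d2, d3, d4]
  rw [show 2 * (p + 1) = 2 * p + 1 + 1 by ring, show n + 2 + p = n + p + 1 + 1 by ring,
    show n + 1 + p = n + p + 1 by ring, show n + (p + 1) = n + p + 1 by ring]
  simp only [Nat.factorial_succ]
  have hp : (p.factorial : ℝ) ≠ 0 := by positivity
  have hp1 : (p : ℝ) + 1 ≠ 0 := by positivity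
  push_cast
  field_simp
  ring

theorem dixonCoeff_of_gt {n : ℕ} (p : ℕ) {k : ℤ} (hk : (n : ℤ) < k) : dixonCoeff n p k = 0 := by
  rw [dixonCoeff, invFactorial_of_neg (by omega : (n : ℤ) - k < 0)]; simp

theorem dixonCoeff_of_neg (n p : ℕ) {k : ℤ} (hk : k < 0) : dixonCoeff n p k = 0 := by
  rw [dixonCoeff, invFactorial_of_neg hk]; simp

theorem invFactorial_pos {m : ℤ} (hm : 0 ≤ m) : 0 < invFactorial m := by
  rw [invFactorial, if_neg (by omega)]; positivity

theorem dixonCoeff_pos (n p : ℕ) {k : ℤ} (h0 : 0 ≤ k) (hk : k ≤ n) : 0 < dixonCoeff n p k := by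
  have := invFactorial_pos (by omega : 0 ≤ (p : ℤ) + k)
  have := invFactorial_pos (by omega : 0 ≤ (p : ℤ) + n - k)
  have := invFactorial_pos h0
  have := invFactorial_pos (by omega : 0 ≤ (n : ℤ) - k)
  unfold dixonCoeff
  positivity

theorem dixonCoeff_zero_right (n k : ℕ) : dixonCoeff n 0 k = (n.choose k : ℝ) ^ 2 := by
  rcases le_or_gt k n with h | h
  · rw [dixonCoeff, Nat.cast_choose ℝ h]
    rw [show ((0 : ℕ) : ℤ) + n - k = ((n - k : ℕ) : ℤ) by push_cast [h]; ring,
      show (n : ℤ) - k = ((n - k : ℕ) : ℤ) by push_cast [h]; ring]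
    simp only [Nat.cast_zero, zero_add, invFactorial_natCast]
    simp
    field_simp
  · rw [dixonCoeff_of_gt 0 (by omega), Nat.choose_eq_zero_of_lt h]; simp

/-- The generating polynomial of `dixonCoeff n p`. -/
noncomputable def dixonPolynomial (n p : ℕ) : ℂ[X] :=
  ∑ k ∈ Finset.range (n + 1), C (dixonCoeff n p k : ℂ) * X ^ k

theorem coeff_dixonPolynomial (n p k : ℕ) :
    (dixonPolynomial n p).coeff k = dixonCoeff n p k := by
  simp only [dixonPolynomial, finsetSum_coeff, coeff_C_mul_X_pow]
  rw [Finset.sum_ite_eq]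
  split_ifs with h
  · rfl
  · rw [dixonCoeff_of_gt p (by simp at h; omega)]; simp

theorem dixonPolynomial_recurrence (n p : ℕ) :
    -(X * dixonPolynomial n (p + 1)) =
      dixonPolynomial (n + 2) p - 2 * ((1 + X) * dixonPolynomial (n + 1) p)
        + (1 - X) ^ 2 * dixonPolynomial n p := by
  have h : dixonPolynomial (n + 2) p - 2 * ((1 + X) * dixonPolynomial (n + 1) p)
      + (1 - X) ^ 2 * dixonPolynomial n p = dixonPolynomial (n + 2) p
        - C 2 * dixonPolynomial (n + 1) p - C 2 * (X * dixonPolynomial (n + 1) p)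
        + dixonPolynomial n p - C 2 * (X * dixonPolynomial n p)
        + X * (X * dixonPolynomial n p) := by
    rw [show (C 2 : ℂ[X]) = 2 from rfl]; ring
  rw [h]
  ext k
  have key := congrArg (fun x : ℝ => (x : ℂ)) (dixonCoeff_recurrence n p k)
  rcases k with _ | _ | k
  · simp only [coeff_neg, coeff_add, coeff_sub, coeff_C_mul, coeff_X_mul_zero,
      coeff_dixonPolynomial]
    simp only [dixonCoeff_of_neg _ _ (by norm_num : ((0 : ℕ) : ℤ) - 1 < 0),
      dixonCoeff_of_neg _ _ (by norm_num : ((0 : ℕ) : ℤ) - 2 < 0)] at key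
    push_cast at key ⊢
    linear_combination key
  · simp only [coeff_neg, coeff_add, coeff_sub, coeff_C_mul, coeff_X_mul_zero, coeff_X_mul,
      coeff_dixonPolynomial]
    simp only [dixonCoeff_of_neg _ _ (by norm_num : ((0 + 1 : ℕ) : ℤ) - 2 < 0),
      show ((0 + 1 : ℕ) : ℤ) - 1 = ((0 : ℕ) : ℤ) by norm_num] at key
    push_cast at key ⊢
    linear_combination key
  · simp only [coeff_neg, coeff_add, coeff_sub, coeff_C_mul, coeff_X_mul, coeff_dixonPolynomial]
    simp only [show ((k + 1 + 1 : ℕ) : ℤ) - 1 = ((k + 1 : ℕ) : ℤ) by push_cast; ring,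
      show ((k + 1 + 1 : ℕ) : ℤ) - 2 = (k : ℤ) by push_cast; ring] at key
    push_cast at key ⊢
    linear_combination key

theorem eval_dixonPolynomial (n p : ℕ) (x : ℂ) :
    (dixonPolynomial n p).eval x = ∑ k ∈ Finset.range (n + 1), (dixonCoeff n p k : ℂ) * x ^ k := by
  simp [dixonPolynomial, eval_finsetSum]

theorem eval_dixonPolynomial_ofReal_ne_zero (n p : ℕ) {r : ℝ} (hr : 0 ≤ r) :
    (dixonPolynomial n p).eval (r : ℂ) ≠ 0 := by
  have hpos : 0 < ∑ k ∈ Finset.range (n + 1), dixonCoeff n p k * r ^ k := by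
    refine Finset.sum_pos' (fun k hk => ?_) ⟨0, by simp, ?_⟩
    · have := dixonCoeff_pos n p (k := k) (by omega) (by simp at hk; omega)
      positivity
    · simpa using dixonCoeff_pos n p (k := 0) le_rfl (by omega)
  rw [eval_dixonPolynomial]
  exact_mod_cast hpos.ne'

/-! ### Zeros of the Dixon polynomials. -/

theorem rootSet_iterate_derivative_subset (f : ℂ[X]) (k : ℕ) :
    (derivative^[k] f).rootSet ℂ ⊆ convexHull ℝ (f.rootSet ℂ) := by
  induction k with
  | zero => exact subset_convexHull ℝ _
  | succ k ih =>
    rw [Function.iterate_succ_apply']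
    rcases lt_or_ge 0 (derivative^[k] f).degree with h | h
    · exact (rootSet_derivative_subset_convexHull_rootSet h).trans
        (convexHull_min ih (convex_convexHull ℝ _))
    · rw [eq_C_of_degree_le_zero h]; simp

/-- A Rodrigues formula: the `k`-th Leibniz term carries `y^(p+k) (y+1)^(n+p-k)`, which is `y^p
(y+1)^(n+p)` times the `k`-th power of `y/(y+1)`. -/
theorem eval_iterate_derivative_eq_dixonPolynomial (n p : ℕ) {y : ℂ} (hy : y + 1 ≠ 0) :
    ((2 * p).factorial : ℂ) * (derivative^[n] (X ^ (n + p) * (X + C 1) ^ (n + p) : ℂ[X])).eval y =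
      (n + p).factorial * p.factorial * y ^ p * (y + 1) ^ (n + p) *
        (dixonPolynomial n p).eval (y / (y + 1)) := by
  rw [iterate_derivative_mul, eval_finsetSum, eval_dixonPolynomial, Finset.mul_sum,
    Finset.mul_sum]
  refine Finset.sum_congr rfl fun k hk => ?_
  have hkn : k ≤ n := by simp at hk; omega
  obtain ⟨m, rfl⟩ := Nat.exists_eq_add_of_le hkn
  rw [iterate_derivative_X_pow_eq_natCast_mul, iterate_derivative_X_add_pow, dixonCoeff]
  rw [show (p : ℤ) + (k + m : ℕ) - k = ((m + p : ℕ) : ℤ) by push_cast; ring,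
    show ((k + m : ℕ) : ℤ) - k = (m : ℤ) by push_cast; ring,
    show (p : ℤ) + k = ((k + p : ℕ) : ℤ) by push_cast; ring]
  simp only [invFactorial_natCast]
  rw [Nat.add_sub_cancel_left, show k + m + p - m = k + p by omega,
    show k + m + p - k = m + p by omega]
  have h1 : ((k + p).factorial : ℂ) * (k + m + p).descFactorial m = (k + m + p).factorial := by
    have := Nat.factorial_mul_descFactorial (show m ≤ k + m + p by omega)
    rw [show k + m + p - m = k + p by omega] at this
    exact_mod_cast this
  have h2 : ((m + p).factorial : ℂ) * (k + m + p).descFactorial k = (k + m + p).factorial := by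
    have := Nat.factorial_mul_descFactorial (show k ≤ k + m + p by omega)
    rw [show k + m + p - k = m + p by omega] at this
    exact_mod_cast this
  have h3 : ((k + m).choose k : ℂ) = (k + m).factorial / (k.factorial * m.factorial) := by
    rw [Nat.cast_choose ℂ hkn, Nat.add_sub_cancel_left]
  have nz : ∀ j : ℕ, (j.factorial : ℂ) ≠ 0 := fun j => by exact_mod_cast j.factorial_ne_zero
  have h1' := eq_div_of_mul_eq (nz (k + p)) ((mul_comm _ _).trans h1)
  have h2' := eq_div_of_mul_eq (nz (m + p)) ((mul_comm _ _).trans h2)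
  simp only [nsmul_eq_mul, eval_mul, eval_natCast, eval_pow, eval_X, eval_add, eval_C]
  rw [h1', h2', h3]
  have e1 := nz (k + p)
  have e2 := nz (m + p)
  have e3 := nz k
  have e4 := nz m
  have e5 := nz p
  push_cast
  rw [div_pow]
  field_simp
  ring

/-- The point `y = x/(1-x)` is a zero of the Rodrigues derivative, so Gauss–Lucas puts it in `[-1,
0]`. Then `x = y/(1+y) ≤ 0`, and positivity of the coefficients excludes `x = 0`. -/
theorem re_neg_of_eval_dixonPolynomial_eq_zero {n p : ℕ} {x : ℂ}
    (hx : (dixonPolynomial n p).eval x = 0) : x.im = 0 ∧ x.re < 0 := by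
  have hx1 : 1 - x ≠ 0 := fun h => by
    have h' : x = ((1 : ℝ) : ℂ) := by push_cast; linear_combination -h
    exact eval_dixonPolynomial_ofReal_ne_zero n p zero_le_one (h' ▸ hx)
  suffices h : ∃ r : ℝ, r ≤ 0 ∧ x = r by
    obtain ⟨r, hr, rfl⟩ := h
    refine ⟨Complex.ofReal_im r, lt_of_le_of_ne hr fun h => ?_⟩
    exact eval_dixonPolynomial_ofReal_ne_zero n p (h ▸ le_rfl) hx
  set f : ℂ[X] := X ^ (n + p) * (X + C 1) ^ (n + p) with hf
  -- Needed because the `rootSet` of the zero polynomial is empty; `y = 1` corresponds to `x = 1/2`.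
  have hD : derivative^[n] f ≠ 0 := fun h0 => by
    have := eval_iterate_derivative_eq_dixonPolynomial n p (y := 1) (by norm_num)
    rw [← hf, h0, eval_zero, mul_zero] at this
    have h2 := eval_dixonPolynomial_ofReal_ne_zero n p (r := 1 / 2) (by norm_num)
    push_cast at h2
    have nz : ∀ j : ℕ, (j.factorial : ℂ) ≠ 0 := fun j => by exact_mod_cast j.factorial_ne_zero
    rw [one_add_one_eq_two] at this
    rw [one_pow, mul_one] at this
    exact mul_ne_zero (mul_ne_zero (mul_ne_zero (nz _) (nz _)) (pow_ne_zero _ two_ne_zero)) h2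
      this.symm
  have hy1 : x / (1 - x) + 1 = 1 / (1 - x) := by field_simp; ring
  have hy1' : x / (1 - x) + 1 ≠ 0 := by rw [hy1]; exact one_div_ne_zero hx1
  have hroot := eval_iterate_derivative_eq_dixonPolynomial n p hy1'
  rw [show x / (1 - x) / (x / (1 - x) + 1) = x by rw [hy1]; field_simp, hx, mul_zero] at hroot
  have hroot' : x / (1 - x) ∈ (derivative^[n] f).rootSet ℂ := by
    rw [mem_rootSet, coe_aeval_eq_eval]
    refine ⟨hD, (mul_eq_zero.1 hroot).resolve_left ?_⟩
    exact_mod_cast (2 * p).factorial_ne_zero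
  have hsub : f.rootSet ℂ ⊆ segment ℝ (-1 : ℂ) 0 := by
    intro z hz
    rw [mem_rootSet, coe_aeval_eq_eval, hf] at hz
    have h := hz.2
    simp only [eval_mul, eval_pow, eval_X, eval_add, eval_C, mul_eq_zero] at h
    rcases h with h | h
    · rw [eq_zero_of_pow_eq_zero h]; exact right_mem_segment ℝ _ _
    · rw [eq_neg_of_add_eq_zero_left (eq_zero_of_pow_eq_zero h)]; exact left_mem_segment ℝ _ _
  obtain ⟨a, b, ha, hb, hab, hxy⟩ := convexHull_min hsub (convex_segment _ _)
    (rootSet_iterate_derivative_subset f n hroot')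
  rw [smul_zero, add_zero] at hxy
  have hya : x / (1 - x) = ((-a : ℝ) : ℂ) := by rw [← hxy]; simp
  have hb0 : (b : ℂ) ≠ 0 := by
    intro hb0
    rw [hya] at hy1'
    apply hy1'
    have : a = 1 := by have : b = 0 := by exact_mod_cast hb0
                       linarith
    simp [this]
  refine ⟨-a / b, div_nonpos_of_nonpos_of_nonneg (by linarith) hb, ?_⟩
  push_cast
  rw [eq_div_iff hb0]
  rw [div_eq_iff hx1] at hya
  have habc : (a : ℂ) + b = 1 := by exact_mod_cast hab
  push_cast at hya
  linear_combination hya + x * habc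

/-! ### Constant terms of Laurent polynomials. -/

section ConstantTerm

open LaurentPolynomial

/-- The constant term of a complex Laurent polynomial. -/
noncomputable def constantTerm : ℂ[T;T⁻¹] →ₗ[ℂ] ℂ where
  toFun f := f.coeff 0
  map_add' f g := by simp
  map_smul' c f := by simp

theorem constantTerm_T (m : ℤ) : constantTerm (T m) = if m = 0 then 1 else 0 :=
  T_apply 0 m

/-- The functional `f ↦ CT (f * (z - z⁻¹) ^ (2p))`. -/
noncomputable def weightedConstantTerm (p : ℕ) : ℂ[T;T⁻¹] →ₗ[ℂ] ℂ :=
  constantTerm.comp (LinearMap.mulRight ℂ ((T 1 - T (-1)) ^ (2 * p)))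

theorem weightedConstantTerm_apply (p : ℕ) (f : ℂ[T;T⁻¹]) :
    weightedConstantTerm p f = constantTerm (f * (T 1 - T (-1)) ^ (2 * p)) := rfl

theorem T_one_mul_T_neg_one : (T 1 * T (-1) : ℂ[T;T⁻¹]) = 1 := by
  rw [← T_add]; simp

/-- Extension by zero of a sequence to negative indices. -/
noncomputable def extendByZero (α : ℕ → ℂ) (k : ℤ) : ℂ := if k < 0 then 0 else α k.toNat

theorem extendByZero_eq_sum {α : ℕ → ℂ} {n : ℕ} (hα : ∀ i, n < i → α i = 0) (k : ℤ) :
    extendByZero α k = ∑ i ∈ Finset.range (n + 1), if (i : ℤ) = k then α i else 0 := by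
  unfold extendByZero
  split_ifs with h
  · exact (Finset.sum_eq_zero fun i _ => if_neg (by omega)).symm
  · obtain ⟨m, rfl⟩ := Int.eq_ofNat_of_zero_le (not_lt.1 h)
    simp only [Nat.cast_inj, Int.toNat_natCast, Finset.sum_ite_eq', Finset.mem_range]
    split_ifs with hm
    · rfl
    · exact hα m (by omega)

theorem constantTerm_mul_mul_T {α : ℕ → ℂ} {n : ℕ} (hα : ∀ i, n < i → α i = 0) (j : ℤ) :
    constantTerm ((∑ i ∈ Finset.range (n + 1), α i • T (i : ℤ)) *
        (∑ i ∈ Finset.range (n + 1), α i • T (-(i : ℤ))) * T (-(2 * j))) =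
      ∑ k ∈ Finset.range (n + 1), extendByZero α (k - j) * extendByZero α (k + j) := by
  have hL : ∀ i l : ℕ, constantTerm (α i • T (i : ℤ) * α l • T (-(l : ℤ)) * T (-(2 * j))) =
      if (i : ℤ) - l = 2 * j then α i * α l else 0 := by
    intro i l
    rw [smul_mul_smul_comm, smul_mul_assoc, ← T_add, ← T_add, map_smul, constantTerm_T,
      smul_eq_mul, mul_ite, mul_one, mul_zero]
    congr 1
    exact propext ⟨fun h => by omega, fun h => by omega⟩
  rw [Finset.sum_mul_sum, Finset.sum_mul, map_sum]
  simp_rw [Finset.sum_mul, map_sum, hL, extendByZero_eq_sum hα, Finset.sum_mul_sum]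
  have hR : ∀ i ∈ Finset.range (n + 1), ∀ l ∈ Finset.range (n + 1),
      (∑ k ∈ Finset.range (n + 1),
        (if (l : ℤ) = k - j then α l else 0) * (if (i : ℤ) = k + j then α i else 0)) =
      if (i : ℤ) - l = 2 * j then α i * α l else 0 := by
    intro i hi l hl
    rw [Finset.mem_range] at hi hl
    split_ifs with h
    -- This `m` is the midpoint of `i` and `l`, so it stays in the range of summation.
    · obtain ⟨m, hm⟩ : ∃ m : ℕ, (m : ℤ) = l + j := ⟨(l + j).toNat, by omega⟩
      rw [Finset.sum_eq_single m]
      · rw [if_pos (by omega), if_pos (by omega), mul_comm]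
      · intro k _ hk
        rw [if_neg (by omega), zero_mul]
      · intro hk
        rw [Finset.mem_range] at hk
        omega
    · refine Finset.sum_eq_zero fun k _ => ?_
      by_cases h1 : (l : ℤ) = k - j
      · rw [if_neg (show ¬ (i : ℤ) = k + j by omega), mul_zero]
      · rw [if_neg h1, zero_mul]
  rw [Finset.sum_comm]
  calc _ = ∑ l ∈ Finset.range (n + 1), ∑ i ∈ Finset.range (n + 1), ∑ k ∈ Finset.range (n + 1),
        (if (l : ℤ) = k - j then α l else 0) * (if (i : ℤ) = k + j then α i else 0) :=
        Finset.sum_congr rfl fun l hl => Finset.sum_congr rfl fun i hi => (hR i hi l hl).symm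
    _ = _ := by
      symm
      rw [Finset.sum_comm]
      exact Finset.sum_congr rfl fun l _ => Finset.sum_comm

theorem T_sub_T_pow (p : ℕ) :
    (T 1 - T (-1) : ℂ[T;T⁻¹]) ^ (2 * p) = ∑ m ∈ Finset.range (2 * p + 1),
      ((-1) ^ m * ((2 * p).choose m : ℂ)) • T (-(2 * ((p : ℤ) - m))) := by
  rw [sub_eq_add_neg, add_pow]
  refine Finset.sum_congr rfl fun m hm => ?_
  have hm' : m ≤ 2 * p := by simp at hm; omega
  have hsign : (-1 : ℂ[T;T⁻¹]) ^ (2 * p - m) = (-1) ^ m := by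
    have : (-1 : ℂ[T;T⁻¹]) ^ (2 * p - m) * (-1) ^ m * (-1) ^ m = (-1) ^ m := by
      rw [← pow_add, Nat.sub_add_cancel hm', pow_mul]; simp
    rwa [mul_assoc, ← mul_pow, neg_mul_neg, one_mul, one_pow, mul_one] at this
  rw [neg_pow, hsign, T_pow, T_pow, Algebra.smul_def, map_mul, map_pow, map_neg, map_one,
    map_natCast]
  have : (T (-(2 * ((p : ℤ) - m))) : ℂ[T;T⁻¹]) = T (m * 1) * T (((2 * p - m : ℕ) : ℤ) * -1) := by
    rw [← T_add]
    congr 1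
    push_cast [hm']
    ring
  rw [this]
  ring

theorem weightedConstantTerm_mul {α : ℕ → ℂ} {n : ℕ} (hα : ∀ i, n < i → α i = 0) (p : ℕ) :
    weightedConstantTerm p ((∑ i ∈ Finset.range (n + 1), α i • T (i : ℤ)) *
        (∑ i ∈ Finset.range (n + 1), α i • T (-(i : ℤ)))) =
      ∑ m ∈ Finset.range (2 * p + 1), (-1) ^ m * ((2 * p).choose m : ℂ) *
        ∑ k ∈ Finset.range (n + 1),
          extendByZero α (k - ((p : ℤ) - m)) * extendByZero α (k + ((p : ℤ) - m)) := by
  rw [weightedConstantTerm_apply, T_sub_T_pow, Finset.mul_sum, map_sum]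
  refine Finset.sum_congr rfl fun m _ => ?_
  rw [mul_smul_comm, map_smul, smul_eq_mul, constantTerm_mul_mul_T hα]

theorem weightedConstantTerm_succ (p : ℕ) (f : ℂ[T;T⁻¹]) :
    weightedConstantTerm (p + 1) f =
      weightedConstantTerm p (f * ((T 1 + T (-1)) ^ 2 - 4)) := by
  rw [weightedConstantTerm_apply, weightedConstantTerm_apply]
  congr 1
  have : (T 1 + T (-1) : ℂ[T;T⁻¹]) ^ 2 - 4 = (T 1 - T (-1)) ^ 2 := by
    linear_combination 4 * T_one_mul_T_neg_one
  rw [this]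
  ring

/-- Induction on `p` for all `n` at once. For `p = 0` the base factors as `(1 + tz)(1 + t/z)`,
giving squared binomials; the step is the Dixon recurrence. -/
theorem weightedConstantTerm_pow_eq_dixonPolynomial {t : ℂ} (ht : t ≠ 0) (p : ℕ) :
    ∀ n : ℕ, weightedConstantTerm p
        ((algebraMap ℂ ℂ[T;T⁻¹] (1 + t ^ 2) + algebraMap ℂ _ t * (T 1 + T (-1))) ^ n) =
      (-1) ^ p * (dixonPolynomial n p).eval (t ^ 2) := by
  induction p with
  | zero =>
    intro n
    have hfac : (algebraMap ℂ ℂ[T;T⁻¹] (1 + t ^ 2) + algebraMap ℂ _ t * (T 1 + T (-1))) =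
        (1 + algebraMap ℂ _ t * T 1) * (1 + algebraMap ℂ _ t * T (-1)) := by
      rw [map_add, map_one, map_pow]
      linear_combination (-algebraMap ℂ ℂ[T;T⁻¹] t ^ 2) * T_one_mul_T_neg_one
    have hexp : ∀ m : ℤ, (1 + algebraMap ℂ ℂ[T;T⁻¹] t * T m) ^ n =
        ∑ i ∈ Finset.range (n + 1), ((n.choose i : ℂ) * t ^ i) • T (i * m) := by
      intro m
      rw [add_comm, add_pow]
      refine Finset.sum_congr rfl fun i _ => ?_
      rw [Algebra.smul_def, map_mul, map_natCast, map_pow, mul_pow, T_pow, one_pow]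
      ring
    have := weightedConstantTerm_mul (α := fun i => (n.choose i : ℂ) * t ^ i) (n := n)
      (fun i hi => by simp [Nat.choose_eq_zero_of_lt hi]) 0
    rw [hfac, mul_pow, hexp, hexp]
    simp only [mul_one, mul_neg] at this ⊢
    rw [this, eval_dixonPolynomial]
    simp [extendByZero, dixonCoeff_zero_right]
    refine Finset.sum_congr rfl fun k _ => ?_
    have hk : ¬ (k : ℤ) < 0 := by omega
    simp only [hk, if_false]
    ring
  | succ p ih =>
    intro n
    rw [weightedConstantTerm_succ]
    set X₀ := algebraMap ℂ ℂ[T;T⁻¹] (1 + t ^ 2) + algebraMap ℂ _ t * (T 1 + T (-1)) with hX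
    have hring : t ^ 2 • (X₀ ^ n * ((T 1 + T (-1)) ^ 2 - 4)) =
        X₀ ^ (n + 2) - (2 * (1 + t ^ 2)) • X₀ ^ (n + 1) + ((1 - t ^ 2) ^ 2) • X₀ ^ n := by
      simp only [Algebra.smul_def, hX, map_add, map_sub, map_mul, map_pow, map_one, map_ofNat]
      ring
    have h := congrArg (weightedConstantTerm p) hring
    rw [map_smul, map_add, map_sub, map_smul, map_smul, ih, ih, ih] at h
    simp only [smul_eq_mul] at h
    have hrec := congrArg (eval (t ^ 2)) (dixonPolynomial_recurrence n p)
    simp only [eval_neg, eval_mul, eval_X, eval_add, eval_sub, eval_pow, eval_one,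
      eval_ofNat] at hrec
    apply mul_left_cancel₀ (pow_ne_zero 2 ht)
    rw [h]
    linear_combination (-(-1) ^ p) * hrec

theorem weightedConstantTerm_one_ne_zero (p : ℕ) : weightedConstantTerm p 1 ≠ 0 := by
  have h := weightedConstantTerm_pow_eq_dixonPolynomial one_ne_zero p 0
  rw [pow_zero] at h
  rw [h]
  have := eval_dixonPolynomial_ofReal_ne_zero 0 p (r := 1 ^ 2) (by norm_num)
  push_cast at this
  exact mul_ne_zero (pow_ne_zero _ (by norm_num)) this

theorem weightedConstantTerm_add_pow_ne_zero (p n : ℕ) {w : ℂ} (hw : 0 < w.re) :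
    weightedConstantTerm p ((algebraMap ℂ _ w + (T 1 + T (-1))) ^ n) ≠ 0 := by
  obtain ⟨s, hs⟩ := IsAlgClosed.exists_pow_nat_eq (w ^ 2 - 4) two_pos
  -- Joukowski substitution `w = t + t⁻¹`; since `Re w = Re t * (1 + 1/|t|²)`, the right half-plane
  -- is respected.
  obtain ⟨t, ht⟩ : ∃ t : ℂ, t ^ 2 + 1 = t * w := ⟨(w + s) / 2, by linear_combination hs / 4⟩
  have ht0 : t ≠ 0 := by rintro rfl; simp at ht
  have hwt : w = t + t⁻¹ := by field_simp; linear_combination -ht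
  have htre : 0 < t.re := by
    rw [hwt, Complex.add_re, Complex.inv_re, div_eq_mul_inv] at hw
    have : 0 < Complex.normSq t := Complex.normSq_pos.2 ht0
    by_contra hneg
    have := mul_nonneg (neg_nonneg.2 (not_lt.1 hneg)) (inv_pos.2 this).le
    linarith
  intro h0
  have h := weightedConstantTerm_pow_eq_dixonPolynomial ht0 p n
  rw [show algebraMap ℂ ℂ[T;T⁻¹] (1 + t ^ 2) + algebraMap ℂ _ t * (T 1 + T (-1)) =
      algebraMap ℂ _ t * (algebraMap ℂ _ w + (T 1 + T (-1))) by
    rw [add_comm 1, ht, map_mul]; ring, mul_pow, ← map_pow, ← Algebra.smul_def, map_smul, h0,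
    smul_zero] at h
  have hx := re_neg_of_eval_dixonPolynomial_eq_zero
    ((mul_eq_zero.1 h.symm).resolve_left (pow_ne_zero _ (by norm_num)))
  rw [pow_two, Complex.mul_im, Complex.mul_re] at hx
  have him : t.im = 0 := by
    have : t.re * t.im = 0 := by linarith [hx.1]
    exact (mul_eq_zero.1 this).resolve_left htre.ne'
  rw [him] at hx
  nlinarith [hx.2]

/-- For a real-rooted polynomial with negative zeros, the constant term of
`φ(tz) φ(t/z) (z - 1/z) ^ (2p)` does not vanish on the right half-plane. -/
theorem weightedConstantTerm_aeval_mul_ne_zero {f : ℂ[X]} (hf0 : f ≠ 0)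
    (hf : ∀ z, f.eval z = 0 → z.im = 0 ∧ z.re < 0) (p : ℕ) {t : ℂ} (ht : 0 < t.re) :
    weightedConstantTerm p (aeval (t • T 1 : ℂ[T;T⁻¹]) f * aeval (t • T (-1) : ℂ[T;T⁻¹]) f)
      ≠ 0 := by
  have ht0 : t ≠ 0 := by rintro rfl; simp at ht
  have hr : ∀ r ∈ f.roots, r ≠ 0 ∧ 0 < ((t ^ 2 + r ^ 2) / (-r * t)).re := by
    intro r hr
    obtain ⟨him, hre⟩ := hf r (mem_roots'.1 hr).2
    obtain ⟨s, rfl⟩ : ∃ s : ℝ, r = (s : ℂ) := ⟨r.re, Complex.ext rfl him⟩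
    rw [Complex.ofReal_re] at hre
    have hs : (s : ℂ) ≠ 0 := by exact_mod_cast hre.ne
    refine ⟨hs, ?_⟩
    -- Positive multiples of `t` and `t⁻¹`, both of positive real part.
    have : (t ^ 2 + (s : ℂ) ^ 2) / (-s * t) = ((-s⁻¹ : ℝ) : ℂ) * t + ((-s : ℝ) : ℂ) * t⁻¹ := by
      push_cast
      field_simp
      ring
    rw [this, Complex.add_re, Complex.re_ofReal_mul, Complex.re_ofReal_mul, Complex.inv_re]
    have h1 : 0 < -s⁻¹ := by rw [neg_pos]; exact inv_lt_zero.2 hre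
    have h2 : 0 < -s := by linarith
    have := Complex.normSq_pos.2 ht0
    positivity
  have hfac := (IsAlgClosed.splits f).eq_prod_roots
  have haev : ∀ x : ℂ[T;T⁻¹], aeval x f = algebraMap ℂ _ f.leadingCoeff *
      (f.roots.map fun r => x - algebraMap ℂ _ r).prod := by
    intro x
    conv_lhs => rw [hfac]
    rw [map_mul, aeval_C, map_multiset_prod, Multiset.map_map]
    simp
  have hprod : aeval (t • T 1 : ℂ[T;T⁻¹]) f * aeval (t • T (-1) : ℂ[T;T⁻¹]) f =
      (f.leadingCoeff ^ 2 * (f.roots.map fun r => -r * t).prod) •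
        ((f.roots.map fun r => (t ^ 2 + r ^ 2) / (-r * t)).map
          fun w => algebraMap ℂ _ w + (T 1 + T (-1))).prod := by
    rw [haev, haev, Algebra.smul_def (_ * _ : ℂ), map_mul, map_pow, map_multiset_prod, Multiset.map_map,
      Multiset.map_map, mul_mul_mul_comm, ← pow_two, mul_assoc, ← Multiset.prod_map_mul,
      ← Multiset.prod_map_mul]
    congr 2
    refine Multiset.map_congr rfl fun r hrm => ?_
    have hr0 := (hr r hrm).1
    have hw : -r * t * ((t ^ 2 + r ^ 2) / (-r * t)) = t ^ 2 + r ^ 2 := by field_simp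
    simp only [Function.comp_apply]
    rw [mul_add, ← map_mul, hw]
    simp only [Algebra.smul_def, map_add, map_mul, map_pow, map_neg]
    linear_combination (algebraMap ℂ ℂ[T;T⁻¹] t ^ 2) * T_one_mul_T_neg_one
  rw [hprod, map_smul, smul_eq_mul]
  refine mul_ne_zero (mul_ne_zero (pow_ne_zero _ (leadingCoeff_ne_zero.2 hf0)) ?_) ?_
  · refine Multiset.prod_ne_zero fun h => ?_
    obtain ⟨r, hrm, h⟩ := Multiset.mem_map.1 h
    exact mul_ne_zero (neg_ne_zero.2 (hr r hrm).1) ht0 h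
  · refine functional_prod_ne_zero _ _ _ (weightedConstantTerm_one_ne_zero p)
      (fun w hw => weightedConstantTerm_add_pow_ne_zero p _ hw) _ rfl fun w hw => ?_
    obtain ⟨r, hrm, rfl⟩ := Multiset.mem_map.1 hw
    exact (hr r hrm).2

end ConstantTerm

/-! ### From the constant term back to the operators. -/

theorem sum_range_two_mul_add_one {M : Type*} [AddCommMonoid M] (f : ℕ → M) (p : ℕ) :
    ∑ m ∈ Finset.range (2 * p + 1), f m =
      f p + ∑ j ∈ Finset.Icc 1 p, (f (p - j) + f (p + j)) := by
  rw [show 2 * p + 1 = p + (p + 1) by ring, Finset.sum_range_add, Finset.sum_range_succ',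
    ← Finset.sum_range_reflect, Finset.sum_add_distrib, add_zero,
    show Finset.Icc 1 p = Finset.Ico 1 (p + 1) from rfl, Finset.sum_Ico_eq_sum_range,
    Finset.sum_Ico_eq_sum_range, Nat.add_sub_cancel]
  rw [← add_assoc, add_comm]
  congr 2
  · exact Finset.sum_congr rfl fun j _ => by congr 1; omega
  · exact Finset.sum_congr rfl fun j _ => by congr 1; omega

theorem alternating_sum_of_even (p : ℕ) (U : ℤ → ℂ) (hU : ∀ j, U (-j) = U j) :
    ∑ m ∈ Finset.range (2 * p + 1), (-1) ^ m * ((2 * p).choose m : ℂ) * U ((p : ℤ) - m) =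
      (-1) ^ p * (((2 * p).choose p : ℂ) * U 0 +
        2 * ∑ j ∈ Finset.Icc 1 p, (-1) ^ j * ((2 * p).choose (p - j) : ℂ) * U j) := by
  rw [sum_range_two_mul_add_one, sub_self, mul_add, Finset.mul_sum, Finset.mul_sum, mul_assoc]
  congr 1
  refine Finset.sum_congr rfl fun j hj => ?_
  obtain ⟨-, hj⟩ := Finset.mem_Icc.1 hj
  have hsign : (-1 : ℂ) ^ (p - j) = (-1) ^ (p + j) := by
    obtain ⟨m, rfl⟩ := Nat.exists_eq_add_of_le hj
    rw [Nat.add_sub_cancel_left, show j + m + j = m + 2 * j by ring, pow_add, pow_mul]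
    simp
  rw [hsign, show (p : ℤ) - ((p - j : ℕ) : ℤ) = j by push_cast [hj]; ring,
    show (p : ℤ) - ((p + j : ℕ) : ℤ) = -j by push_cast; ring, hU,
    Nat.choose_symm_of_eq_add (show 2 * p = (p + j) + (p - j) by omega), pow_add]
  ring

/-- For `p > 0` the full alternating binomial sum vanishes, so the central coefficient can be traded
for the `U 0` terms of the differences. -/
theorem two_mul_sum_choose_mul_sub {p : ℕ} (hp : 0 < p) (U : ℤ → ℂ) (hU : ∀ j, U (-j) = U j) :
    2 * ∑ j ∈ Finset.Icc 1 p,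
        (-1) ^ (j + 1) * ((2 * p).choose (p - j) : ℂ) * (U 0 - U j) =
      (-1) ^ p * ∑ m ∈ Finset.range (2 * p + 1),
        (-1) ^ m * ((2 * p).choose m : ℂ) * U ((p : ℤ) - m) := by
  have hsq : ((-1 : ℂ) ^ p) * (-1) ^ p = 1 := by rw [← mul_pow]; simp
  have h1 := alternating_sum_of_even p (fun _ => 1) fun _ => rfl
  have h0 : ∑ m ∈ Finset.range (2 * p + 1), (-1 : ℂ) ^ m * ((2 * p).choose m : ℂ) = 0 := by
    have := Int.alternating_sum_range_choose_of_ne (n := 2 * p) (by omega)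
    exact_mod_cast congrArg (fun x : ℤ => (x : ℂ)) this
  simp only [mul_one] at h1
  rw [h0] at h1
  have h2 := (mul_eq_zero.1 h1.symm).resolve_left (pow_ne_zero _ (by norm_num))
  rw [alternating_sum_of_even p U hU, ← mul_assoc, hsq, one_mul]
  have h3 : ∑ j ∈ Finset.Icc 1 p, (-1) ^ (j + 1) * ((2 * p).choose (p - j) : ℂ) * (U 0 - U j) =
      -(U 0 * ∑ j ∈ Finset.Icc 1 p, (-1) ^ j * ((2 * p).choose (p - j) : ℂ)) +
        ∑ j ∈ Finset.Icc 1 p, (-1) ^ j * ((2 * p).choose (p - j) : ℂ) * U j := by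
    rw [Finset.mul_sum, ← Finset.sum_neg_distrib, ← Finset.sum_add_distrib]
    exact Finset.sum_congr rfl fun j _ => by rw [pow_succ]; ring
  rw [h3]
  linear_combination (-U 0) * h2

theorem aeval_fiskOperator (j n : ℕ) (φ : ℝ[X]) (z : ℂ) :
    aeval z (fiskOperator j n φ) = ∑ k ∈ Finset.range (n + 1),
      ((intCoeff φ k : ℂ) ^ 2 - intCoeff φ ((k : ℤ) - j) * intCoeff φ ((k : ℤ) + j)) * z ^ k := by
  simp [fiskOperator]

theorem extendByZero_mul_extendByZero (φ : ℝ[X]) (t : ℂ) (k : ℕ) (j : ℤ) :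
    extendByZero (fun i => (φ.coeff i : ℂ) * t ^ i) (k - j) *
        extendByZero (fun i => (φ.coeff i : ℂ) * t ^ i) (k + j) =
      intCoeff φ (k - j) * intCoeff φ (k + j) * (t ^ 2) ^ k := by
  unfold extendByZero intCoeff
  split_ifs with h1 h2 h2
  · simp
  · simp
  · simp
  · rw [mul_mul_mul_comm, ← pow_add, ← pow_mul]
    congr 2
    omega

theorem two_mul_aeval_sum_fiskOperator {n : ℕ} {φ : ℝ[X]} (hn : φ.natDegree ≤ n) {p : ℕ}
    (hp : 0 < p) (t : ℂ) :
    2 * aeval (t ^ 2) (∑ j ∈ Finset.Icc 1 p,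
        C ((-1 : ℝ) ^ (j + 1) * ((Nat.choose (2 * p) (p - j) : ℕ) : ℝ)) * fiskOperator j n φ) =
      (-1) ^ p * weightedConstantTerm p
        (aeval (t • LaurentPolynomial.T 1 : LaurentPolynomial ℂ) (φ.map Complex.ofRealHom) *
          aeval (t • LaurentPolynomial.T (-1) : LaurentPolynomial ℂ)
            (φ.map Complex.ofRealHom)) := by
  have haev : ∀ m : ℤ,
      aeval (t • LaurentPolynomial.T m : LaurentPolynomial ℂ) (φ.map Complex.ofRealHom) =
        ∑ i ∈ Finset.range (n + 1),
          ((φ.coeff i : ℂ) * t ^ i) • (LaurentPolynomial.T (i * m) : LaurentPolynomial ℂ) := by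
    intro m
    rw [aeval_eq_sum_range' (lt_of_le_of_lt natDegree_map_le (Nat.lt_succ_of_le hn))]
    refine Finset.sum_congr rfl fun i _ => ?_
    rw [_root_.smul_pow, LaurentPolynomial.T_pow, smul_smul]
    simp
  rw [haev, haev]
  simp only [mul_one, mul_neg]
  rw [weightedConstantTerm_mul (α := fun i => (φ.coeff i : ℂ) * t ^ i) fun i hi => by
    rw [coeff_eq_zero_of_natDegree_lt (lt_of_le_of_lt hn hi)]; simp]
  simp_rw [extendByZero_mul_extendByZero]
  rw [← two_mul_sum_choose_mul_sub hp (fun j => ∑ k ∈ Finset.range (n + 1),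
    (intCoeff φ (k - j) * intCoeff φ (k + j) * (t ^ 2) ^ k : ℂ)) fun j =>
      Finset.sum_congr rfl fun k _ => by
        rw [sub_neg_eq_add, ← sub_eq_add_neg, mul_comm (intCoeff φ (k + j) : ℂ)]]
  rw [map_sum]
  congr 1
  refine Finset.sum_congr rfl fun j _ => ?_
  rw [map_mul, aeval_C, aeval_fiskOperator, ← Finset.sum_sub_distrib]
  congr 1
  · simp
  · refine Finset.sum_congr rfl fun k _ => ?_
    rw [sub_zero, add_zero]
    ring

theorem proposition4p2 (n : ℕ) (φ : ℝ[X]) (hn : φ.natDegree ≤ n)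
    (hφ : HasOnlyRealNegativeZeros φ) (p : ℕ) (hp : 0 < p) :
    HasOnlyRealNegativeZeros
      (∑ j ∈ Finset.Icc 1 p,
        C ((-1 : ℝ) ^ (j + 1) * ((Nat.choose (2 * p) (p - j) : ℕ) : ℝ)) * fiskOperator j n φ) := by
  intro z hz
  have heval : ∀ w, (φ.map Complex.ofRealHom).eval w = aeval w φ := fun w => by
    rw [eval_map, aeval_def]; rfl
  have h0 : (φ.map Complex.ofRealHom).eval 0 ≠ 0 := fun h => by
    simpa using (hφ 0 (heval 0 ▸ h)).2
  have hf0 : φ.map Complex.ofRealHom ≠ 0 := fun h => h0 (by rw [h, eval_zero])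
  have hne : ∀ t : ℂ, t ^ 2 = z → ¬ 0 < t.re := by
    rintro t rfl ht
    have h := two_mul_aeval_sum_fiskOperator hn hp t
    rw [hz, mul_zero] at h
    exact mul_ne_zero (pow_ne_zero _ (by norm_num))
      (weightedConstantTerm_aeval_mul_ne_zero hf0 (fun w hw => hφ w (heval w ▸ hw)) p ht) h.symm
  obtain ⟨t, ht⟩ := IsAlgClosed.exists_pow_nat_eq z two_pos
  have h1 := hne t ht
  have h2 := hne (-t) (by rw [neg_sq, ht])
  rw [Complex.neg_re] at h2
  have hre : t.re = 0 := by linarith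
  have ht0 : t ≠ 0 := by
    rintro rfl
    -- At `t = 0` both factors are the constant `φ(0)`, so the functional gives `φ(0)² L(1) ≠ 0`.
    have h := two_mul_aeval_sum_fiskOperator hn hp 0
    rw [ht, hz, mul_zero, zero_smul, zero_smul, ← coeff_zero_eq_aeval_zero', ← map_mul,
      Algebra.algebraMap_eq_smul_one, map_smul, coeff_zero_eq_eval_zero] at h
    exact mul_ne_zero (pow_ne_zero p (by norm_num))
      (smul_ne_zero (mul_ne_zero h0 h0) (weightedConstantTerm_one_ne_zero p)) h.symm
  subst ht
  have him : t.im ≠ 0 := fun h => ht0 (Complex.ext hre h)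
  rw [pow_two, Complex.mul_im, Complex.mul_re, hre]
  refine ⟨by ring, ?_⟩
  have := mul_self_pos.2 him
  linarith
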